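/- **Setting.** Fix $d\ge 0$, real polynomials $q_1,q_2$ in two variables and $B,b\in\mathbb N$. Let $\mathcal X=\mathcal Y=[-1,1]^d$ and let $\mathscr K:\mathcal X\times\mathcal Y\to\mathbb R$ be a kernel. Let $\overline X,\overline Y\subset[-1,1]^d$ be tensor grids of Chebyshev nodes of the first kind (in one dimension, $\bar x_k=\cos\frac{(2k-1)\pi}{2m}$, $k=1,\dots,m$, with weights $w_k=\frac{\pi}{m}\sin\frac{(2k-1)\pi}{2m}$), with at least one node in each direction, product weights $\overline W_X,\overline W_Y$, and tensor Lagrange basis functions $S_k$, $T_l$. The numbers of nodes may differ between directions and between the grids. Put $r_0=\min(|\overline X|,|\overline Y|)$, assume that $\max(|\overline X|,|\overline Y|)\le B\,r_0^{\,b}$, and let $$K_w=\operatorname{diag}(\overline W_X)^{1/2}\,\mathscr K(\overline X,\overline Y)\,\operatorname{diag}(\overline W_Y)^{1/2}.$$ A *strong rank-revealing QR factorization with $k$ pivots* of a matrix $A$ with $n$ columns is a factorization $A\Pi=[Q_1\;Q_2]\begin{bmatrix}R_{11}&R_{12}\\0&R_{22}\end{bmatrix}$, with $\Pi$ a permutation,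 $Q$ orthogonal, $R$ upper triangular and $R_{11}\in\mathbb R^{k\times k}$ invertible, such that, with $A_1$ the $k$ selected columns, $T=R_{11}^{-1}R_{12}$ and $E=A\Pi-A_1[I\;T]$, $$\sigma_i(A)\le q_1(n,k)\,\sigma_i(A_1)\ (1\le i\le k),\qquad \sigma_j(E)\le q_1(n,k)\,\sigma_{k+j}(A)\ (j\ge1),\qquad \|T\|_F\le q_2(n,k).$$ Let $\widehat Y\subset\overline Y$, $|\widehat Y|=r_1$, be the points of the columns that such a factorization of $K_w$ selects (with interpolation operator $\widecheck T^\top$), and let $\widehat X\subset\overline X$, $|\widehat X|=r_1$, be the points that such a factorization of the transpose of these columns of $K_w$ selects (with interpolation operator $\widecheck S^\top$). With $\hat K_w$ the block of $K_w$ at $\widehat X\times\widehat Y$, and the selected rows and columns ordered first, put $$E_{\mathrm{QR}}=K_w-\begin{bmatrix}I\\ \widecheck S\end{bmatrix}\hat K_w\begin{bmatrix}I&\widecheck T^\top\end{bmatrix},\qquad \epsilon=\|E_{\mathrm{QR}}\|_2 .$$ Assume that for some $\delta\le\epsilon$ $$\Big|\mathscr K(x,y)-\sum_{k,l}S_k(x)\,\mathscr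 K(\bar x_k,\bar y_l)\,T_l(y)\Big|\le\delta\qquad\text{for all }x\in\mathcal X,\ y\in\mathcal Y .$$ **Lemma 4.** There are a polynomial $q(r_0,r_1)$ and a constant $C>0$, which depend only on $d,q_1,q_2,B,b$ (in particular not on $\mathscr K$, the grids, $r_1$, $\delta$, $\epsilon$ or the conditioning of $\mathscr K(\widehat X,\widehat Y)$), such that in every situation as above $\mathscr K(\widehat X,\widehat Y)$ is invertible and, for all $x\in\mathcal X$, $y\in\mathcal Y$, $$\|\mathscr K(x,\widehat Y)\,\mathscr K(\widehat X,\widehat Y)^{-1}\|_2\le C\,q(r_0,r_1),\qquad \|\mathscr K(\widehat X,\widehat Y)^{-1}\,\mathscr K(\widehat X,y)\|_2\le C\,q(r_0,r_1).$$ Moreover the condition number $\kappa_2(A)=\|A\|_2\|A^{-1}\|_2$ of $\mathscr K(\widehat X,\widehat Y)$ is at most of order $\epsilon^{-1}$: $$\epsilon\;\kappa_2\big(\mathscr K(\widehat X,\widehat Y)\big)\le C\,q(r_0,r_1)\,\|\mathscr K(\widehat X,\widehat Y)\|_2 .$$ -/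

import Mathlib

open scoped Matrix.Norms.L2Operator

noncomputable section

namespace SkelInterp

/-! ### Chebyshev grids, weights and interpolation on `[-1,1]^d`

Indices start from `0`, so `2k-1` for `k = 1, …, m` becomes `2k+1` for `k : Fin m`. -/

/-- The Chebyshev nodes of the first kind on `[-1,1]`. -/
def chebNode (m : ℕ) (k : Fin m) : ℝ :=
  Real.cos ((2 * (k : ℝ) + 1) / (2 * (m : ℝ)) * Real.pi)

/-- The integration weights of the Chebyshev nodes of the first kind. -/
def chebWeight (m : ℕ) (k : Fin m) : ℝ :=
  Real.pi / (m : ℝ) * Real.sin ((2 * (k : ℝ) + 1) / (2 * (m : ℝ)) * Real.pi)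

/-- Index set of a tensor grid with `m i` nodes in direction `i`. -/
abbrev Grid {d : ℕ} (m : Fin d → ℕ) : Type := (i : Fin d) → Fin (m i)

/-- The points of the tensor grid of Chebyshev nodes. -/
def gridPoint {d : ℕ} (m : Fin d → ℕ) (k : Grid m) : Fin d → ℝ :=
  fun i => chebNode (m i) (k i)

/-- The integration weights of the tensor grid. -/
def gridWeight {d : ℕ} (m : Fin d → ℕ) (k : Grid m) : ℝ :=
  ∏ i, chebWeight (m i) (k i)

/-- The Lagrange basis function of the grid point with index `k`, evaluated at `x`. -/
def gridLagrange {d : ℕ} (m : Fin d → ℕ) (k : Grid m) (x : Fin d → ℝ) : ℝ :=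
  ∏ i, (Lagrange.basis Finset.univ (chebNode (m i)) (k i)).eval (x i)

/-- The cube `[-1,1]^d`. -/
def cube (d : ℕ) : Set (Fin d → ℝ) := {x | ∀ i, x i ∈ Set.Icc (-1 : ℝ) 1}

/-- The matrix `K(X, Y)` of a kernel at two finite families of points. -/
def kernelMatrix {d : ℕ} {ι κ : Type} (K : (Fin d → ℝ) → (Fin d → ℝ) → ℝ)
    (X : ι → Fin d → ℝ) (Y : κ → Fin d → ℝ) : Matrix ι κ ℝ :=
  Matrix.of fun i j => K (X i) (Y j)

/-- The error `E_INT(x, y)` of tensor Chebyshev interpolation of the kernel. -/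
def interpError {d : ℕ} (K : (Fin d → ℝ) → (Fin d → ℝ) → ℝ) (m n : Fin d → ℕ)
    (x y : Fin d → ℝ) : ℝ :=
  K x y - ∑ k : Grid m, ∑ l : Grid n,
    gridLagrange m k x * K (gridPoint m k) (gridPoint n l) * gridLagrange n l y

/-- The weighted node matrix `K_w = diag(W_X)^{1/2} K(X, Y) diag(W_Y)^{1/2}` on the grids. -/
def weightedMatrix {d : ℕ} (K : (Fin d → ℝ) → (Fin d → ℝ) → ℝ) (m n : Fin d → ℕ) :
    Matrix (Grid m) (Grid n) ℝ :=
  Matrix.diagonal (fun k => Real.sqrt (gridWeight m k)) *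
    kernelMatrix K (gridPoint m) (gridPoint n) *
    Matrix.diagonal (fun l => Real.sqrt (gridWeight n l))

/-! ### Strong rank-revealing QR factorizations -/

/-- The singular values of a real matrix in decreasing order, starting from index `0`;
they vanish beyond the size of the matrix. -/
def singVal {ι κ : Type} [Fintype ι] [Fintype κ] [DecidableEq κ]
    (A : Matrix ι κ ℝ) (i : ℕ) : ℝ :=
  (Matrix.toEuclideanLin A).singularValues i

/-- The Frobenius norm. -/
def frobNorm {ι κ : Type} [Fintype ι] [Fintype κ] (A : Matrix ι κ ℝ) : ℝ :=
  Real.sqrt (∑ i, ∑ j, A i j ^ 2)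

/-- A column-pivoted QR factorization `A Π = [Q₁ Q₂] [R₁₁ R₁₂; 0 R₂₂]` with `k` pivots.
The number of columns of `A` is `k + p`; orthogonality of `Q` forces the number of rows to be
`k + l`. -/
structure PivotedQR {ι κ : Type} [Fintype ι] [DecidableEq ι]
    (A : Matrix ι κ ℝ) (k : ℕ) where
  /-- number of rows that remain -/
  l : ℕ
  /-- number of columns that are not selected -/
  p : ℕ
  /-- the column permutation; the selected columns come first -/
  perm : Fin k ⊕ Fin p ≃ κ
  Q : Matrix ι (Fin k ⊕ Fin l) ℝ
  R₁₁ : Matrix (Fin k) (Fin k) ℝ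
  R₁₂ : Matrix (Fin k) (Fin p) ℝ
  R₂₂ : Matrix (Fin l) (Fin p) ℝ
  orth_left : Q.transpose * Q = 1
  orth_right : Q * Q.transpose = 1
  upper₁₁ : ∀ i j : Fin k, j < i → R₁₁ i j = 0
  upper₂₂ : ∀ (i : Fin l) (j : Fin p), (j : ℕ) < (i : ℕ) → R₂₂ i j = 0
  factor : A.submatrix id perm = Q * Matrix.fromBlocks R₁₁ R₁₂ 0 R₂₂

namespace PivotedQR

variable {ι κ : Type} [Fintype ι] [DecidableEq ι] {A : Matrix ι κ ℝ} {k : ℕ}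

/-- Indices of the selected columns. -/
def sel (F : PivotedQR A k) (i : Fin k) : κ := F.perm (Sum.inl i)

/-- The selected columns `A₁`. -/
def cols (F : PivotedQR A k) : Matrix ι (Fin k) ℝ := A.submatrix id F.sel

/-- The interpolation operator `T = R₁₁⁻¹ R₁₂`. -/
def interp (F : PivotedQR A k) : Matrix (Fin k) (Fin F.p) ℝ := F.R₁₁⁻¹ * F.R₁₂

/-- The error `E = A Π - A₁ [I T]`. -/
def err (F : PivotedQR A k) : Matrix ι (Fin k ⊕ Fin F.p) ℝ :=
  A.submatrix id F.perm - F.cols * Matrix.fromCols (1 : Matrix (Fin k) (Fin k) ℝ) F.interp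

/-- The factorization is a *strong* rank-revealing one, with polynomials `q₁(n, k)` and
`q₂(n, k)`, where `n` is the number of columns of `A`:
`σᵢ(A₁) ≥ σᵢ(A) / q₁`, `σⱼ(E) ≤ σ_{k+j}(A) q₁` and `‖T‖_F ≤ q₂`. -/
structure IsStrong [Fintype κ] [DecidableEq κ] (F : PivotedQR A k)
    (q₁ q₂ : MvPolynomial (Fin 2) ℝ) : Prop where
  isUnit : IsUnit F.R₁₁
  lower : ∀ i < k, singVal A i ≤
    MvPolynomial.eval ![(Fintype.card κ : ℝ), (k : ℝ)] q₁ * singVal F.cols i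
  upper : ∀ j, singVal F.err j ≤
    singVal A (k + j) * MvPolynomial.eval ![(Fintype.card κ : ℝ), (k : ℝ)] q₁
  interp_le : frobNorm F.interp ≤ MvPolynomial.eval ![(Fintype.card κ : ℝ), (k : ℝ)] q₂

end PivotedQR

/-! ### Skeletonized interpolation -/

/-- The skeletonization (CUR decomposition) of `K_w` by two successive strong rank-revealing QR
factorizations with `r₁` pivots: the first selects columns of `K_w`, the second selects rows of
the selected columns. -/
structure Skeleton {d : ℕ} (K : (Fin d → ℝ) → (Fin d → ℝ) → ℝ) (m n : Fin d → ℕ) (r₁ : ℕ)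
    (q₁ q₂ : MvPolynomial (Fin 2) ℝ) where
  colQR : PivotedQR (weightedMatrix K m n) r₁
  colQR_strong : colQR.IsStrong q₁ q₂
  rowQR : PivotedQR colQR.cols.transpose r₁
  rowQR_strong : rowQR.IsStrong q₁ q₂

namespace Skeleton

variable {d : ℕ} {K : (Fin d → ℝ) → (Fin d → ℝ) → ℝ} {m n : Fin d → ℕ} {r₁ : ℕ}
  {q₁ q₂ : MvPolynomial (Fin 2) ℝ}

/-- The selected points `X̂`. -/
def Xhat (s : Skeleton K m n r₁ q₁ q₂) (i : Fin r₁) : Fin d → ℝ := gridPoint m (s.rowQR.sel i)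

/-- The selected points `Ŷ`. -/
def Yhat (s : Skeleton K m n r₁ q₁ q₂) (j : Fin r₁) : Fin d → ℝ := gridPoint n (s.colQR.sel j)

/-- The error `E_QR = Π_rᵀ K_w Π_c - [I; S] K̂_w [I Tᵀ]`, where `K̂_w` is the selected
`r₁ × r₁` block of `K_w`. -/
def errQR (s : Skeleton K m n r₁ q₁ q₂) :
    Matrix (Fin r₁ ⊕ Fin s.rowQR.p) (Fin r₁ ⊕ Fin s.colQR.p) ℝ :=
  (weightedMatrix K m n).submatrix s.rowQR.perm s.colQR.perm -
    Matrix.fromRows (1 : Matrix (Fin r₁) (Fin r₁) ℝ) s.rowQR.interp.transpose *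
      (weightedMatrix K m n).submatrix s.rowQR.sel s.colQR.sel *
      Matrix.fromCols (1 : Matrix (Fin r₁) (Fin r₁) ℝ) s.colQR.interp

/-- The accuracy `ε = ‖E_QR‖₂`. -/
def eps (s : Skeleton K m n r₁ q₁ q₂) : ℝ := ‖s.errQR‖

/-- The matrix `K(X̂, Ŷ)`. -/
def core (s : Skeleton K m n r₁ q₁ q₂) : Matrix (Fin r₁) (Fin r₁) ℝ :=
  kernelMatrix K s.Xhat s.Yhat

/-- The row vector `K(x, Ŷ) K(X̂, Ŷ)⁻¹`. -/
def leftOp (s : Skeleton K m n r₁ q₁ q₂) (x : Fin d → ℝ) : Matrix Unit (Fin r₁) ℝ :=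
  kernelMatrix K (fun _ : Unit => x) s.Yhat * s.core⁻¹

/-- The column vector `K(X̂, Ŷ)⁻¹ K(X̂, y)`. -/
def rightOp (s : Skeleton K m n r₁ q₁ q₂) (y : Fin d → ℝ) : Matrix (Fin r₁) Unit ℝ :=
  s.core⁻¹ * kernelMatrix K s.Xhat (fun _ : Unit => y)

end Skeleton

/-- The condition number of a square matrix in the spectral norm. -/
def condNumber {r : ℕ} (A : Matrix (Fin r) (Fin r) ℝ) : ℝ := ‖A‖ * ‖A⁻¹‖

/-- The interpolation rank `r₀`, the smaller one of the two grid sizes. -/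
def interpRank {d : ℕ} (m n : Fin d → ℕ) : ℕ :=
  min (Fintype.card (Grid m)) (Fintype.card (Grid n))

end SkelInterp

end

/-!
The moments of a Lagrange basis function against the Chebyshev polynomials are given exactly by
Chebyshev–Gauss quadrature, which bounds its Chebyshev coefficients and gives the bound `2` on
`[-1, 1]`. Hence `K(x, Ŷ)` is, up to the interpolation error `δ`, a bounded combination of the rows
of `K(X̄, Ŷ)`, and these are bounded combinations of the rows of `K(X̂, Ŷ)`: the second QR
factorization acts on a matrix with `r₁` rows, so its error vanishes. Multiplication by
`K(X̂, Ŷ)⁻¹` then only affects error terms of size `ε`. It is harmless on these because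
`ε ≤ ‖E‖ ≤ q₁² σ_min(A₁)` for the first factorization, where `A₁ = [I; S] K̂_w` up to a permutation
of the rows, so that `ε ‖K̂_w⁻¹‖ ≤ q₁² (1 + ‖S‖_F)`. This estimate also bounds the condition number.
-/

namespace SkelInterp

section Lagrange

open Polynomial Polynomial.Chebyshev

theorem integral_sum_smul_T_mul_T {n : ℕ} (c : ℕ → ℝ) {j : ℕ} (hj : j < n) :
    ∫ x, (∑ i ∈ Finset.range n, c i • T ℝ i).eval x * (T ℝ j).eval x ∂measureT =
      c j * ∫ x, (T ℝ j).eval x * (T ℝ j).eval x ∂measureT := by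
  simp_rw [eval_finsetSum, eval_smul, smul_eq_mul, Finset.sum_mul, mul_assoc]
  rw [MeasureTheory.integral_finsetSum _ fun i _ => integrable_measureT (by fun_prop)]
  simp_rw [MeasureTheory.integral_const_mul]
  refine Finset.sum_eq_single_of_mem j (Finset.mem_range.2 hj) fun i _ hij => ?_
  rw [integral_eval_T_real_mul_eval_T_real_measureT_of_ne hij, mul_zero]

theorem pi_div_two_le_integral_T_mul_self (j : ℕ) :
    Real.pi / 2 ≤ ∫ x, (T ℝ j).eval x * (T ℝ j).eval x ∂measureT := by
  rcases eq_or_ne j 0 with rfl | hj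
  · exact (half_le_self Real.pi_pos.le).trans_eq integral_eval_T_real_mul_self_measureT_zero.symm
  · exact (integral_T_real_mul_self_measureT_of_ne_zero hj).ge

theorem abs_eval_le_of_forall_abs_integral_mul_T_le {n : ℕ} {P : ℝ[X]} (hP : P.degree < n) {B : ℝ}
    (hB : ∀ j < n, |∫ t, P.eval t * (T ℝ j).eval t ∂measureT| ≤ B) {x : ℝ} (hx : |x| ≤ 1) :
    |P.eval x| ≤ n * (2 / Real.pi * B) := by
  have hmem : P ∈ degreeLT ℝ n := mem_degreeLT.2 hP
  rw [← Sequence.span_degreeLT (chebyshevTsequence ℝ) (by simp),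
    show Set.Iio n = Finset.range n by simp,
    Submodule.mem_span_image_finset_iff_exists_fun'] at hmem
  obtain ⟨c, rfl : ∑ j ∈ Finset.range n, c j • T ℝ j = P⟩ := hmem
  have hc : ∀ j < n, |c j| ≤ 2 / Real.pi * B := fun j hj => by
    have hcB : |c j| * (Real.pi / 2) ≤ B := by
      refine le_trans ?_ (hB j hj)
      rw [integral_sum_smul_T_mul_T c hj, abs_mul]
      gcongr
      exact (pi_div_two_le_integral_T_mul_self j).trans (le_abs_self _)
    rwa [← le_div_iff₀ (by positivity), div_eq_mul_inv, inv_div, mul_comm] at hcB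
  rw [eval_finsetSum]
  calc |∑ j ∈ Finset.range n, (c j • T ℝ j).eval x|
      ≤ ∑ _j ∈ Finset.range n, 2 / Real.pi * B := by
        refine Finset.abs_sum_le_sum_abs _ _ |>.trans (Finset.sum_le_sum fun j hj => ?_)
        rw [eval_smul, smul_eq_mul, abs_mul]
        exact (mul_le_of_le_one_right (abs_nonneg _) (abs_eval_T_real_le_one j hx)).trans
          (hc j (Finset.mem_range.1 hj))
    _ = n * (2 / Real.pi * B) := by simp

theorem chebNode_injective (m : ℕ) : Function.Injective (chebNode m) := by
  intro k l h
  have hm : (0 : ℝ) < m := by exact_mod_cast k.pos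
  have hmem (k : Fin m) : (2 * (k : ℝ) + 1) / (2 * m) * Real.pi ∈ Set.Icc 0 Real.pi := by
    have hk : (k : ℝ) + 1 ≤ m := by exact_mod_cast k.2
    refine ⟨by positivity, mul_le_of_le_one_left Real.pi_pos.le ?_⟩
    rw [div_le_one (by positivity)]
    linarith
  have hangle := mul_right_cancel₀ Real.pi_pos.ne' (Real.injOn_cos (hmem k) (hmem l) h)
  field_simp at hangle
  exact Fin.ext (by exact_mod_cast (by linarith : (k : ℝ) = l))

theorem abs_chebNode_le_one (m : ℕ) (k : Fin m) : |chebNode m k| ≤ 1 :=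
  Real.abs_cos_le_one _

theorem integral_eval_eq_sum_chebNode {m : ℕ} (hm : m ≠ 0) {P : ℝ[X]} (hP : P.degree < 2 * m) :
    ∫ x, P.eval x ∂measureT = Real.pi / m * ∑ k, P.eval (chebNode m k) := by
  rw [integral_eq_sumZeroes hm hP, sumZeroes, Finset.sum_range]
  rfl

theorem integral_basis_chebNode_mul_T {m : ℕ} (k : Fin m) {j : ℕ} (hj : j < m) :
    ∫ x, (Lagrange.basis Finset.univ (chebNode m) k).eval x * (T ℝ j).eval x ∂measureT =
      Real.pi / m * (T ℝ j).eval (chebNode m k) := by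
  have hdeg : (Lagrange.basis Finset.univ (chebNode m) k * T ℝ j).degree < 2 * m := by
    rw [degree_mul, Lagrange.degree_basis (chebNode_injective m).injOn (Finset.mem_univ k),
      degree_T, Finset.card_univ, Fintype.card_fin, Int.natAbs_natCast]
    norm_cast
    omega
  simp_rw [← eval_mul]
  rw [integral_eval_eq_sum_chebNode k.pos.ne' hdeg, Finset.sum_eq_single_of_mem k
    (Finset.mem_univ k) fun l _ hl => ?_, eval_mul,
    Lagrange.eval_basis_self (chebNode_injective m).injOn (Finset.mem_univ k), one_mul]
  rw [eval_mul, Lagrange.eval_basis_of_ne hl.symm (Finset.mem_univ l), zero_mul]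

theorem abs_eval_basis_chebNode_le_two {m : ℕ} (k : Fin m) {x : ℝ} (hx : |x| ≤ 1) :
    |(Lagrange.basis Finset.univ (chebNode m) k).eval x| ≤ 2 := by
  have hm : (0 : ℝ) < m := by exact_mod_cast k.pos
  have hdeg : (Lagrange.basis Finset.univ (chebNode m) k).degree < m := by
    rw [Lagrange.degree_basis (chebNode_injective m).injOn (Finset.mem_univ k),
      Finset.card_univ, Fintype.card_fin]
    exact_mod_cast Nat.sub_lt k.pos one_pos
  have hmoment : ∀ j < m, |∫ t, (Lagrange.basis Finset.univ (chebNode m) k).eval t *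
      (T ℝ j).eval t ∂measureT| ≤ Real.pi / m := fun j hj => by
    rw [integral_basis_chebNode_mul_T k hj, abs_mul, abs_of_pos (by positivity)]
    exact mul_le_of_le_one_right (by positivity)
      (abs_eval_T_real_le_one j (abs_chebNode_le_one m k))
  refine (abs_eval_le_of_forall_abs_integral_mul_T_le hdeg hmoment hx).trans_eq ?_
  field_simp

end Lagrange

section Grid

variable {d : ℕ} (m : Fin d → ℕ)

theorem gridPoint_mem_cube (k : Grid m) : gridPoint m k ∈ cube d :=
  fun i => abs_le.1 (abs_chebNode_le_one (m i) (k i))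

theorem gridLagrange_gridPoint (k l : Grid m) :
    gridLagrange m k (gridPoint m l) = if k = l then 1 else 0 := by
  split_ifs with h
  · subst h
    exact Finset.prod_eq_one fun i _ =>
      Lagrange.eval_basis_self (chebNode_injective _).injOn (Finset.mem_univ _)
  · obtain ⟨i, hi⟩ := Function.ne_iff.1 h
    exact Finset.prod_eq_zero (Finset.mem_univ i)
      (Lagrange.eval_basis_of_ne hi (Finset.mem_univ _))

theorem abs_gridLagrange_le (k : Grid m) {x : Fin d → ℝ} (hx : x ∈ cube d) :
    |gridLagrange m k x| ≤ 2 ^ d := by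
  rw [gridLagrange, Finset.abs_prod]
  calc ∏ i, |(Lagrange.basis Finset.univ (chebNode (m i)) (k i)).eval (x i)|
      ≤ ∏ _i : Fin d, (2 : ℝ) := Finset.prod_le_prod (fun _ _ => abs_nonneg _)
        fun i _ => abs_eval_basis_chebNode_le_two (k i) (abs_le.2 (hx i))
    _ = 2 ^ d := by simp

end Grid

section Weights

theorem two_mul_le_sin_mul_pi {t : ℝ} (ht₀ : 0 ≤ t) (ht : t ≤ 1 / 2) :
    2 * t ≤ Real.sin (t * Real.pi) := by
  have hjordan : 2 / Real.pi * (t * Real.pi) ≤ Real.sin (t * Real.pi) :=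
    Real.mul_le_sin (by positivity) (by nlinarith [Real.pi_pos])
  rwa [div_mul_eq_mul_div, ← mul_assoc, mul_div_cancel_right₀ _ Real.pi_ne_zero] at hjordan

theorem inv_le_sin_chebNode_angle {m : ℕ} (k : Fin m) :
    (m : ℝ)⁻¹ ≤ Real.sin ((2 * (k : ℝ) + 1) / (2 * m) * Real.pi) := by
  have hm : (0 : ℝ) < m := by exact_mod_cast k.pos
  have hk : (k : ℝ) + 1 ≤ m := by exact_mod_cast k.2
  set t : ℝ := (2 * (k : ℝ) + 1) / (2 * m) with ht
  have hlower : (m : ℝ)⁻¹ ≤ 2 * t := by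
    rw [ht]; field_simp; linarith [(k : ℕ).cast_nonneg (α := ℝ)]
  have hupper : (m : ℝ)⁻¹ ≤ 2 * (1 - t) := by
    rw [ht]; field_simp; linarith
  rcases le_total t (1 / 2) with h | h
  · exact hlower.trans (two_mul_le_sin_mul_pi (by positivity) h)
  · rw [← Real.sin_pi_sub, show Real.pi - t * Real.pi = (1 - t) * Real.pi by ring]
    have hinv : 0 ≤ (m : ℝ)⁻¹ := by positivity
    exact hupper.trans (two_mul_le_sin_mul_pi (by linarith) (by linarith))

theorem inv_sq_le_chebWeight {m : ℕ} (k : Fin m) : ((m : ℝ) ^ 2)⁻¹ ≤ chebWeight m k := by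
  have hpi : (m : ℝ)⁻¹ ≤ Real.pi / m := by
    rw [inv_eq_one_div]
    gcongr
    linarith [Real.pi_gt_three]
  rw [chebWeight, sq, mul_inv]
  exact mul_le_mul hpi (inv_le_sin_chebNode_angle k) (by positivity) (by positivity)

theorem chebWeight_le_pi {m : ℕ} (k : Fin m) : chebWeight m k ≤ Real.pi := by
  have hm : (1 : ℝ) ≤ m := by exact_mod_cast k.pos
  exact (mul_le_of_le_one_right (by positivity) (Real.sin_le_one _)).trans
    (div_le_self Real.pi_pos.le hm)

variable {d : ℕ} {m : Fin d → ℕ} (k : Grid m)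

theorem gridWeight_le : gridWeight m k ≤ Real.pi ^ d := by
  calc gridWeight m k ≤ ∏ _i : Fin d, Real.pi :=
        Finset.prod_le_prod (fun i _ => le_trans (by positivity) (inv_sq_le_chebWeight (k i)))
          fun i _ => chebWeight_le_pi (k i)
    _ = Real.pi ^ d := by simp

theorem inv_card_sq_le_gridWeight : ((Fintype.card (Grid m) : ℝ) ^ 2)⁻¹ ≤ gridWeight m k := by
  calc ((Fintype.card (Grid m) : ℝ) ^ 2)⁻¹ = ∏ i, ((m i : ℝ) ^ 2)⁻¹ := by
        simp [Fintype.card_pi, Finset.prod_pow]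
    _ ≤ gridWeight m k :=
        Finset.prod_le_prod (fun i _ => by positivity) fun i _ => inv_sq_le_chebWeight (k i)

theorem gridWeight_pos : 0 < gridWeight m k :=
  have : Nonempty (Grid m) := ⟨k⟩
  lt_of_lt_of_le (by positivity) (inv_card_sq_le_gridWeight k)

theorem sqrt_gridWeight_le : √(gridWeight m k) ≤ Real.pi ^ d := by
  have hpi : (1 : ℝ) ≤ Real.pi ^ d := one_le_pow₀ (by linarith [Real.pi_gt_three])
  rw [Real.sqrt_le_left (by positivity)]
  exact (gridWeight_le k).trans (le_self_pow₀ hpi two_ne_zero)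

theorem inv_sqrt_gridWeight_le : (√(gridWeight m k))⁻¹ ≤ Fintype.card (Grid m) := by
  have : Nonempty (Grid m) := ⟨k⟩
  rw [inv_le_comm₀ (Real.sqrt_pos.2 (gridWeight_pos k)) (by positivity)]
  apply Real.le_sqrt_of_sq_le
  rw [inv_pow]
  exact inv_card_sq_le_gridWeight k

end Weights

section Norms

variable {ι κ : Type} [Fintype ι] [Fintype κ]

theorem norm_toLp_comp_le (v : κ → ℝ) {f : ι → κ} (hf : Function.Injective f) :
    ‖WithLp.toLp 2 (v ∘ f)‖ ≤ ‖WithLp.toLp 2 v‖ := by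
  rw [EuclideanSpace.norm_eq, EuclideanSpace.norm_eq]
  refine Real.sqrt_le_sqrt ?_
  calc ∑ i, ‖v (f i)‖ ^ 2 = ∑ j ∈ Finset.univ.map ⟨f, hf⟩, ‖v j‖ ^ 2 := by
        rw [Finset.sum_map]; rfl
    _ ≤ ∑ j, ‖v j‖ ^ 2 :=
        Finset.sum_le_sum_of_subset_of_nonneg (Finset.subset_univ _) fun _ _ _ => sq_nonneg _

variable [DecidableEq κ]

theorem norm_toLp_mulVec_le (A : Matrix ι κ ℝ) (v : κ → ℝ) :
    ‖WithLp.toLp 2 (A.mulVec v)‖ ≤ ‖A‖ * ‖WithLp.toLp 2 v‖ :=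
  Matrix.l2_opNorm_mulVec A (WithLp.toLp 2 v)

theorem norm_le_of_forall_norm_toLp_mulVec_le {A : Matrix ι κ ℝ} {c : ℝ} (hc : 0 ≤ c)
    (h : ∀ v : κ → ℝ, ‖WithLp.toLp 2 (A.mulVec v)‖ ≤ c * ‖WithLp.toLp 2 v‖) : ‖A‖ ≤ c := by
  rw [Matrix.l2_opNorm_def]
  exact ContinuousLinearMap.opNorm_le_bound _ hc fun v => h v.ofLp

theorem norm_one_matrix_le : ‖(1 : Matrix κ κ ℝ)‖ ≤ 1 :=
  norm_le_of_forall_norm_toLp_mulVec_le zero_le_one fun v => by rw [Matrix.one_mulVec, one_mul]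

theorem norm_transpose [DecidableEq ι] (A : Matrix ι κ ℝ) : ‖A.transpose‖ = ‖A‖ := by
  rw [← Matrix.conjTranspose_eq_transpose_of_trivial, Matrix.l2_opNorm_conjTranspose]

theorem norm_submatrix_rows_le {ι' : Type} [Fintype ι'] (A : Matrix ι κ ℝ) {f : ι' → ι}
    (hf : Function.Injective f) : ‖A.submatrix f id‖ ≤ ‖A‖ :=
  norm_le_of_forall_norm_toLp_mulVec_le (norm_nonneg _) fun v =>
    (norm_toLp_comp_le (A.mulVec v) hf).trans (norm_toLp_mulVec_le A v)

theorem norm_submatrix_le {ι' κ' : Type} [Fintype ι'] [Fintype κ'] [DecidableEq κ']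
    (A : Matrix ι κ ℝ) {f : ι' → ι} {g : κ' → κ} (hf : Function.Injective f)
    (hg : Function.Injective g) : ‖A.submatrix f g‖ ≤ ‖A‖ := by
  classical
  calc ‖A.submatrix f g‖ = ‖(A.submatrix f id).transpose.submatrix g id‖ := by
        rw [← norm_transpose]; rfl
    _ ≤ ‖(A.submatrix f id).transpose‖ := norm_submatrix_rows_le _ hg
    _ ≤ ‖A‖ := by rw [norm_transpose]; exact norm_submatrix_rows_le A hf

theorem norm_fromCols_le {κ' : Type} [Fintype κ'] [DecidableEq κ'] (A : Matrix ι κ ℝ)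
    (B : Matrix ι κ' ℝ) : ‖Matrix.fromCols A B‖ ≤ ‖A‖ + ‖B‖ := by
  refine norm_le_of_forall_norm_toLp_mulVec_le (by positivity) fun v => ?_
  rw [Matrix.fromCols_mulVec, WithLp.toLp_add, add_mul]
  refine (norm_add_le _ _).trans (add_le_add ?_ ?_)
  · exact (norm_toLp_mulVec_le A _).trans <|
      mul_le_mul_of_nonneg_left (norm_toLp_comp_le v Sum.inl_injective) (norm_nonneg A)
  · exact (norm_toLp_mulVec_le B _).trans <|
      mul_le_mul_of_nonneg_left (norm_toLp_comp_le v Sum.inr_injective) (norm_nonneg B)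

omit [DecidableEq κ] in
theorem frobNorm_nonneg (A : Matrix ι κ ℝ) : 0 ≤ frobNorm A :=
  Real.sqrt_nonneg _

theorem norm_le_frobNorm (A : Matrix ι κ ℝ) : ‖A‖ ≤ frobNorm A := by
  refine norm_le_of_forall_norm_toLp_mulVec_le (frobNorm_nonneg A) fun v => ?_
  rw [EuclideanSpace.norm_eq, EuclideanSpace.norm_eq, frobNorm,
    ← Real.sqrt_mul (by positivity), Finset.sum_mul]
  refine Real.sqrt_le_sqrt (Finset.sum_le_sum fun i _ => ?_)
  simp_rw [Real.norm_eq_abs, sq_abs]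
  exact Finset.sum_mul_sq_le_sq_mul_sq Finset.univ (A i) v

theorem norm_le_card_mul_of_forall_abs_le {A : Matrix ι κ ℝ} {c : ℝ} (hc : 0 ≤ c)
    (h : ∀ i j, |A i j| ≤ c) : ‖A‖ ≤ Fintype.card ι * Fintype.card κ * c := by
  refine (norm_le_frobNorm A).trans (Real.sqrt_le_iff.2 ⟨by positivity, ?_⟩)
  have hcard : ((Fintype.card ι * Fintype.card κ : ℕ) : ℝ) ≤
      ((Fintype.card ι * Fintype.card κ : ℕ) : ℝ) ^ 2 := by
    exact_mod_cast Nat.le_self_pow two_ne_zero _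
  calc ∑ i, ∑ j, A i j ^ 2 ≤ ∑ _i : ι, ∑ _j : κ, c ^ 2 := by
        refine Finset.sum_le_sum fun i _ => Finset.sum_le_sum fun j _ => ?_
        exact sq_le_sq.2 ((h i j).trans (le_abs_self c))
    _ = ((Fintype.card ι * Fintype.card κ : ℕ) : ℝ) * c ^ 2 := by simp [mul_assoc]
    _ ≤ ((Fintype.card ι * Fintype.card κ : ℕ) : ℝ) ^ 2 * c ^ 2 := by gcongr
    _ = (Fintype.card ι * Fintype.card κ * c) ^ 2 := by push_cast; ring

theorem norm_mul_mul_le_of_le {μ ν : Type} [Fintype μ] [Fintype ν] [DecidableEq μ]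
    [DecidableEq ν] {A : Matrix ι κ ℝ} {B : Matrix κ μ ℝ} {C : Matrix μ ν ℝ} {a b c : ℝ}
    (hA : ‖A‖ ≤ a) (hB : ‖B‖ ≤ b) (hC : ‖C‖ ≤ c) : ‖A * B * C‖ ≤ a * b * c := by
  have ha := (norm_nonneg A).trans hA
  have hb := (norm_nonneg B).trans hB
  calc ‖A * B * C‖ ≤ ‖A‖ * ‖B‖ * ‖C‖ := (Matrix.l2_opNorm_mul _ _).trans <|
        mul_le_mul_of_nonneg_right (Matrix.l2_opNorm_mul _ _) (norm_nonneg C)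
    _ ≤ a * b * c := by gcongr

theorem norm_inv_mul_le_of_forall_norm_mulVec_ge (B : Matrix ι κ ℝ) {C : Matrix κ κ ℝ}
    (hC : IsUnit C.det) {ε c : ℝ} (hε : 0 ≤ ε) (hc : 0 ≤ c)
    (h : ∀ v : κ → ℝ, ε * ‖WithLp.toLp 2 v‖ ≤ c * ‖WithLp.toLp 2 ((B * C).mulVec v)‖) :
    ‖C⁻¹‖ * ε ≤ c * ‖B‖ := by
  suffices ‖ε • C⁻¹‖ ≤ c * ‖B‖ by rwa [norm_smul, Real.norm_of_nonneg hε, mul_comm] at this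
  refine norm_le_of_forall_norm_toLp_mulVec_le (by positivity) fun w => ?_
  calc ‖WithLp.toLp 2 ((ε • C⁻¹).mulVec w)‖ = ε * ‖WithLp.toLp 2 (C⁻¹.mulVec w)‖ := by
        rw [Matrix.smul_mulVec, WithLp.toLp_smul, norm_smul, Real.norm_of_nonneg hε]
    _ ≤ c * ‖WithLp.toLp 2 ((B * C).mulVec (C⁻¹.mulVec w))‖ := h _
    _ = c * ‖WithLp.toLp 2 (B.mulVec w)‖ := by
        rw [Matrix.mulVec_mulVec, Matrix.mul_nonsing_inv_cancel_right _ _ hC]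
    _ ≤ c * (‖B‖ * ‖WithLp.toLp 2 w‖) := by gcongr; exact norm_toLp_mulVec_le B w
    _ = c * ‖B‖ * ‖WithLp.toLp 2 w‖ := by ring

end Norms

section SingularValues

open LinearMap

variable {𝕜 E F : Type*} [RCLike 𝕜] [NormedAddCommGroup E] [InnerProductSpace 𝕜 E]
  [FiniteDimensional 𝕜 E] [NormedAddCommGroup F] [InnerProductSpace 𝕜 F]
  [FiniteDimensional 𝕜 F] (T : E →ₗ[𝕜] F)

theorem norm_sq_apply_eq_sum_singularValues (v : E) :
    ‖T v‖ ^ 2 = ∑ i : Fin (Module.finrank 𝕜 E), T.singularValues i ^ 2 *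
      ‖inner 𝕜 (T.isSymmetric_adjoint_comp_self.eigenvectorBasis rfl i) v‖ ^ 2 := by
  set b := T.isSymmetric_adjoint_comp_self.eigenvectorBasis rfl with hb
  have hgram : inner 𝕜 (T v) (T v) = inner 𝕜 v ((adjoint T ∘ₗ T) v) := by
    rw [comp_apply, adjoint_inner_right]
  have hcoord (i) : inner 𝕜 (b i) ((adjoint T ∘ₗ T) v) =
      ((T.singularValues i ^ 2 : ℝ) : 𝕜) * inner 𝕜 (b i) v := by
    rw [← T.isSymmetric_adjoint_comp_self (b i) v, hb,
      T.isSymmetric_adjoint_comp_self.apply_eigenvectorBasis rfl i, inner_smul_left,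
      T.sq_singularValues_fin rfl i, RCLike.conj_ofReal]
  suffices ((‖T v‖ ^ 2 : ℝ) : 𝕜) = ((∑ i : Fin (Module.finrank 𝕜 E), T.singularValues i ^ 2 *
      ‖inner 𝕜 (b i) v‖ ^ 2 : ℝ) : 𝕜) by exact_mod_cast this
  push_cast
  rw [← inner_self_eq_norm_sq_to_K, hgram, ← b.sum_inner_mul_inner]
  refine Finset.sum_congr rfl fun i _ => ?_
  rw [hcoord, ← inner_conj_symm v (b i), mul_left_comm, RCLike.conj_mul, RCLike.ofReal_pow]

theorem norm_apply_le_singularValues_zero_mul (v : E) : ‖T v‖ ≤ T.singularValues 0 * ‖v‖ := by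
  refine le_of_sq_le_sq ?_ (mul_nonneg (T.singularValues_nonneg 0) (norm_nonneg v))
  rw [norm_sq_apply_eq_sum_singularValues, mul_pow,
    ← (T.isSymmetric_adjoint_comp_self.eigenvectorBasis rfl).sum_sq_norm_inner_right v,
    Finset.mul_sum]
  gcongr with i
  · exact T.singularValues_nonneg i
  · exact T.singularValues_antitone (Nat.zero_le i)

theorem singularValues_mul_norm_le_norm_apply {k : ℕ} (hk : Module.finrank 𝕜 E ≤ k + 1) (v : E) :
    T.singularValues k * ‖v‖ ≤ ‖T v‖ := by
  refine le_of_sq_le_sq ?_ (norm_nonneg _)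
  rw [norm_sq_apply_eq_sum_singularValues, mul_pow,
    ← (T.isSymmetric_adjoint_comp_self.eigenvectorBasis rfl).sum_sq_norm_inner_right v,
    Finset.mul_sum]
  gcongr with i
  · exact T.singularValues_nonneg k
  · exact T.singularValues_antitone (by omega)

variable {ι κ : Type} [Fintype ι] [Fintype κ] [DecidableEq κ] (A : Matrix ι κ ℝ)

theorem singVal_nonneg (i : ℕ) : 0 ≤ singVal A i :=
  LinearMap.singularValues_nonneg _ i

theorem singVal_antitone : Antitone (singVal A) :=
  LinearMap.singularValues_antitone _

theorem norm_le_singVal_zero : ‖A‖ ≤ singVal A 0 :=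
  norm_le_of_forall_norm_toLp_mulVec_le (singVal_nonneg A 0) fun v =>
    norm_apply_le_singularValues_zero_mul A.toEuclideanLin (WithLp.toLp 2 v)

theorem singVal_mul_norm_le {k : ℕ} (hk : Fintype.card κ ≤ k + 1) (v : κ → ℝ) :
    singVal A k * ‖WithLp.toLp 2 v‖ ≤ ‖WithLp.toLp 2 (A.mulVec v)‖ :=
  singularValues_mul_norm_le_norm_apply A.toEuclideanLin (by simpa using hk) (WithLp.toLp 2 v)

end SingularValues

namespace PivotedQR

variable {ι κ : Type} [Fintype ι] [DecidableEq ι] {A : Matrix ι κ ℝ} {k : ℕ}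

theorem card_rows (F : PivotedQR A k) : Fintype.card ι = k + F.l := by
  have hle := (congrArg Matrix.rank F.orth_right).symm.trans_le
    ((Matrix.rank_mul_le_left _ _).trans (Matrix.rank_le_card_width F.Q))
  have hge := (congrArg Matrix.rank F.orth_left).symm.trans_le
    ((Matrix.rank_mul_le_right _ _).trans (Matrix.rank_le_card_height F.Q))
  simp only [Matrix.rank_one, Fintype.card_sum, Fintype.card_fin] at hle hge
  exact le_antisymm hle hge

theorem card_cols [Fintype κ] (F : PivotedQR A k) : Fintype.card κ = k + F.p := by
  simp [← Fintype.card_congr F.perm]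

theorem cols_eq_mul_fromRows (F : PivotedQR A k) :
    F.cols = F.Q * Matrix.fromRows F.R₁₁ (0 : Matrix (Fin F.l) (Fin k) ℝ) := by
  ext i j
  simpa [Matrix.mul_apply, cols, sel] using congr_fun (congr_fun F.factor i) (Sum.inl j)

theorem isUnit_det_cols {A : Matrix (Fin k) κ ℝ} (F : PivotedQR A k) (hR : IsUnit F.R₁₁) :
    IsUnit F.cols.det := by
  have hgram : F.cols.transpose * F.cols = F.R₁₁.transpose * F.R₁₁ := by
    rw [F.cols_eq_mul_fromRows, Matrix.transpose_mul, Matrix.mul_assoc,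
      ← Matrix.mul_assoc _ F.Q, F.orth_left, Matrix.one_mul, Matrix.transpose_fromRows,
      Matrix.fromCols_mul_fromRows, Matrix.mul_zero, add_zero]
  have hunit : IsUnit (F.cols.transpose * F.cols).det := by
    rw [hgram, Matrix.det_mul, Matrix.det_transpose]
    have hdet := (Matrix.isUnit_iff_isUnit_det _).1 hR
    exact hdet.mul hdet
  rw [Matrix.det_mul] at hunit
  exact isUnit_of_mul_isUnit_right hunit

/-- The interpolation operator `[I T] Πᵀ`, which expresses all columns of `A`, in their original
order, in terms of the selected ones. -/
noncomputable def extInterp (F : PivotedQR A k) : Matrix (Fin k) κ ℝ :=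
  (Matrix.fromCols (1 : Matrix (Fin k) (Fin k) ℝ) F.interp).submatrix id F.perm.symm

theorem fromCols_one_eq_submatrix_extInterp (F : PivotedQR A k) :
    Matrix.fromCols (1 : Matrix (Fin k) (Fin k) ℝ) F.interp = F.extInterp.submatrix id F.perm := by
  ext i j
  simp [extInterp]

theorem cols_mul_extInterp_of_card_eq (F : PivotedQR A k) (hR : IsUnit F.R₁₁)
    (hι : Fintype.card ι = k) : F.cols * F.extInterp = A := by
  have : IsEmpty (Fin F.l) := by
    rw [show F.l = 0 by have := F.card_rows; omega]
    infer_instance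
  have hinterp : F.R₁₁ * F.interp = F.R₁₂ :=
    Matrix.mul_nonsing_inv_cancel_left _ _ ((Matrix.isUnit_iff_isUnit_det _).1 hR)
  have hblocks : Matrix.fromRows F.R₁₁ (0 : Matrix (Fin F.l) (Fin k) ℝ) *
      Matrix.fromCols (1 : Matrix (Fin k) (Fin k) ℝ) F.interp =
      Matrix.fromBlocks F.R₁₁ F.R₁₂ 0 F.R₂₂ := by
    rw [Matrix.fromRows_mul_fromCols, Matrix.mul_one, hinterp]
    congr 1 <;> exact Subsingleton.elim _ _
  calc F.cols * F.extInterp = (A.submatrix id F.perm).submatrix id F.perm.symm := by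
        rw [F.factor, ← hblocks, ← Matrix.mul_assoc, ← F.cols_eq_mul_fromRows]; rfl
    _ = A := by simp

theorem norm_extInterp_le [Fintype κ] [DecidableEq κ] (F : PivotedQR A k) :
    ‖F.extInterp‖ ≤ 1 + frobNorm F.interp :=
  calc ‖F.extInterp‖ ≤ ‖Matrix.fromCols (1 : Matrix (Fin k) (Fin k) ℝ) F.interp‖ :=
        norm_submatrix_le _ Function.injective_id F.perm.symm.injective
    _ ≤ 1 + frobNorm F.interp := (norm_fromCols_le _ _).trans <|
        add_le_add norm_one_matrix_le (norm_le_frobNorm _)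

theorem IsStrong.norm_err_le [Fintype κ] [DecidableEq κ] {A : Matrix ι κ ℝ}
    {F : PivotedQR A (k + 1)} {q₁ q₂ : MvPolynomial (Fin 2) ℝ} (hF : F.IsStrong q₁ q₂) :
    ‖F.err‖ ≤ MvPolynomial.eval ![(Fintype.card κ : ℝ), ((k + 1 : ℕ) : ℝ)] q₁ ^ 2 *
      singVal F.cols k := by
  set a := MvPolynomial.eval ![(Fintype.card κ : ℝ), ((k + 1 : ℕ) : ℝ)] q₁
  have hlower : singVal A k ≤ |a| * singVal F.cols k :=
    (hF.lower k k.lt_succ_self).trans <|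
      mul_le_mul_of_nonneg_right (le_abs_self a) (singVal_nonneg _ _)
  calc ‖F.err‖ ≤ singVal F.err 0 := norm_le_singVal_zero _
    _ ≤ singVal A (k + 1) * a := hF.upper 0
    _ ≤ singVal A (k + 1) * |a| :=
        mul_le_mul_of_nonneg_left (le_abs_self a) (singVal_nonneg _ _)
    _ ≤ singVal A k * |a| := by gcongr; exact singVal_antitone A k.le_succ
    _ ≤ |a| * singVal F.cols k * |a| := by gcongr
    _ = a ^ 2 * singVal F.cols k := by rw [← sq_abs]; ring

theorem IsStrong.norm_err_mul_norm_le [Fintype κ] [DecidableEq κ] {F : PivotedQR A k}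
    {q₁ q₂ : MvPolynomial (Fin 2) ℝ} (hF : F.IsStrong q₁ q₂) (v : Fin k → ℝ) :
    ‖F.err‖ * ‖WithLp.toLp 2 v‖ ≤
      MvPolynomial.eval ![(Fintype.card κ : ℝ), (k : ℝ)] q₁ ^ 2 *
        ‖WithLp.toLp 2 (F.cols.mulVec v)‖ := by
  cases k with
  | zero =>
    rw [Subsingleton.elim (WithLp.toLp 2 v) 0, norm_zero, mul_zero]
    positivity
  | succ k =>
    refine (mul_le_mul_of_nonneg_right hF.norm_err_le (norm_nonneg _)).trans ?_
    rw [mul_assoc]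
    gcongr
    exact singVal_mul_norm_le F.cols (by simp) v

end PivotedQR

section WeightDiag

variable {d : ℕ} {m n : Fin d → ℕ} {ι κ : Type} [Fintype ι] [DecidableEq ι] [Fintype κ]
  [DecidableEq κ]

/-- The diagonal matrix `diag(W)^{1/2}` of the integration weights of a family of grid points. -/
noncomputable def weightDiag (σ : ι → Grid m) : Matrix ι ι ℝ :=
  Matrix.diagonal fun i => √(gridWeight m (σ i))

theorem isUnit_det_weightDiag (σ : ι → Grid m) : IsUnit (weightDiag σ).det := by
  rw [weightDiag, Matrix.det_diagonal]
  exact (Finset.prod_pos fun i _ => Real.sqrt_pos.2 (gridWeight_pos _)).ne'.isUnit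

theorem norm_weightDiag_le (σ : ι → Grid m) : ‖weightDiag σ‖ ≤ Real.pi ^ d := by
  rw [weightDiag, Matrix.l2_opNorm_diagonal, pi_norm_le_iff_of_nonneg (by positivity)]
  intro i
  rw [Real.norm_of_nonneg (Real.sqrt_nonneg _)]
  exact sqrt_gridWeight_le (σ i)

theorem norm_inv_weightDiag_le (σ : ι → Grid m) :
    ‖(weightDiag σ)⁻¹‖ ≤ Fintype.card (Grid m) := by
  have hinv : (weightDiag σ)⁻¹ = Matrix.diagonal fun i => (√(gridWeight m (σ i)))⁻¹ :=
    Matrix.inv_eq_right_inv <| by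
      simp [weightDiag, Matrix.diagonal_mul_diagonal, (Real.sqrt_pos.2 (gridWeight_pos _)).ne']
  rw [hinv, Matrix.l2_opNorm_diagonal, pi_norm_le_iff_of_nonneg (by positivity)]
  intro i
  rw [Real.norm_of_nonneg (by positivity)]
  exact inv_sqrt_gridWeight_le (σ i)

theorem weightedMatrix_submatrix (K : (Fin d → ℝ) → (Fin d → ℝ) → ℝ) (σ : ι → Grid m)
    (τ : κ → Grid n) :
    (weightedMatrix K m n).submatrix σ τ =
      weightDiag σ * kernelMatrix K (gridPoint m ∘ σ) (gridPoint n ∘ τ) * weightDiag τ := by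
  ext i j
  simp [weightedMatrix, weightDiag, kernelMatrix]

end WeightDiag

section Interpolation

variable {d : ℕ} (K : (Fin d → ℝ) → (Fin d → ℝ) → ℝ) (m n : Fin d → ℕ) {ι κ : Type}

/-- The matrix of the values of the Lagrange basis functions of a grid at a family of points, so
that interpolation in the first variable is multiplication by this matrix from the left. -/
noncomputable def lagrangeMatrix (X : ι → Fin d → ℝ) : Matrix ι (Grid m) ℝ :=
  Matrix.of fun i k => gridLagrange m k (X i)

theorem norm_lagrangeMatrix_le [Fintype ι] {X : ι → Fin d → ℝ} (hX : ∀ i, X i ∈ cube d) :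
    ‖lagrangeMatrix m X‖ ≤ Fintype.card ι * Fintype.card (Grid m) * 2 ^ d :=
  norm_le_card_mul_of_forall_abs_le (by positivity) fun i k => abs_gridLagrange_le m k (hX i)

theorem kernelMatrix_gridPoint_right (X : ι → Fin d → ℝ) (τ : κ → Grid n) :
    kernelMatrix K X (gridPoint n ∘ τ) =
      lagrangeMatrix m X * kernelMatrix K (gridPoint m) (gridPoint n ∘ τ) +
        kernelMatrix (interpError K m n) X (gridPoint n ∘ τ) := by
  ext i j
  simp [Matrix.mul_apply, kernelMatrix, lagrangeMatrix, interpError, gridLagrange_gridPoint]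

theorem kernelMatrix_gridPoint_left (σ : ι → Grid m) (Y : κ → Fin d → ℝ) :
    kernelMatrix K (gridPoint m ∘ σ) Y =
      kernelMatrix K (gridPoint m ∘ σ) (gridPoint n) * (lagrangeMatrix n Y).transpose +
        kernelMatrix (interpError K m n) (gridPoint m ∘ σ) Y := by
  ext i j
  simp only [kernelMatrix, lagrangeMatrix, interpError, gridLagrange_gridPoint, Matrix.add_apply,
    Matrix.mul_apply, Matrix.of_apply, Matrix.transpose_apply, Function.comp_apply]
  rw [Finset.sum_comm]
  simp

end Interpolation

section PolynomialBounds

open MvPolynomial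

theorem exists_forall_abs_eval_le {σ τ : Type*} (p : MvPolynomial σ ℝ)
    (g : σ → MvPolynomial τ ℝ) :
    ∃ P : MvPolynomial τ ℝ, ∀ (x : σ → ℝ) (y : τ → ℝ),
      (∀ i, |x i| ≤ eval y (g i)) → |eval x p| ≤ eval y P := by
  induction p using MvPolynomial.induction_on with
  | C a => exact ⟨C |a|, fun x y _ => by rw [eval_C, eval_C]⟩
  | add p₁ p₂ ih₁ ih₂ =>
    obtain ⟨P₁, h₁⟩ := ih₁
    obtain ⟨P₂, h₂⟩ := ih₂
    refine ⟨P₁ + P₂, fun x y hxy => ?_⟩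
    rw [eval_add, eval_add]
    exact (abs_add_le _ _).trans (add_le_add (h₁ x y hxy) (h₂ x y hxy))
  | mul_X p i ih =>
    obtain ⟨P, h⟩ := ih
    refine ⟨P * g i, fun x y hxy => ?_⟩
    rw [eval_mul, eval_mul, eval_X, abs_mul]
    exact mul_le_mul (h x y hxy) (hxy i) (abs_nonneg _) ((abs_nonneg _).trans (h x y hxy))

theorem exists_forall_abs_eval_le_of_le_mul_pow (p : MvPolynomial (Fin 2) ℝ) (B b : ℕ) :
    ∃ P : MvPolynomial (Fin 2) ℝ, ∀ c r₀ r : ℕ, c ≤ B * r₀ ^ b →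
      |eval ![(c : ℝ), (r : ℝ)] p| ≤ eval ![(r₀ : ℝ), (r : ℝ)] P := by
  obtain ⟨P, hP⟩ := exists_forall_abs_eval_le p
    ![(C (B : ℝ) * X 0 ^ b : MvPolynomial (Fin 2) ℝ), X 1]
  refine ⟨P, fun c r₀ r hc => hP _ _ <| Fin.forall_fin_two.2 ⟨?_, by simp⟩⟩
  simpa using (by exact_mod_cast hc : (c : ℝ) ≤ B * (r₀ : ℝ) ^ b)

/-- The bound of the theorem in terms of bounds `w` for the square roots of the weights, `v` for
the Lagrange basis functions, `N` for the grid sizes, `a` for the value of `q₁` and `t` for the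
norms of the interpolation operators. Over a polynomial semiring the same formula gives the
polynomial of the theorem. -/
def growthBound {R : Type*} [CommSemiring R] (w v N a t : R) : R :=
  w * (1 + t) * N * (v * N) + w ^ 2 * a ^ 2 * (1 + t) * (N * N * (v * N) + N + 1)

theorem map_growthBound {R S : Type*} [CommSemiring R] [CommSemiring S] (f : R →+* S)
    (w v N a t : R) :
    f (growthBound w v N a t) = growthBound (f w) (f v) (f N) (f a) (f t) := by
  simp only [growthBound, map_add, map_mul, map_pow, map_one]

end PolynomialBounds

namespace Skeleton

variable {d : ℕ} {K : (Fin d → ℝ) → (Fin d → ℝ) → ℝ} {m n : Fin d → ℕ} {r₁ : ℕ}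
  {q₁ q₂ : MvPolynomial (Fin 2) ℝ}

theorem rank_le_card_grid (s : Skeleton K m n r₁ q₁ q₂) : r₁ ≤ Fintype.card (Grid m) :=
  s.rowQR.card_cols ▸ Nat.le_add_right _ _

variable (s : Skeleton K m n r₁ q₁ q₂)

/-- The selected block `K̂_w` of the weighted matrix. -/
noncomputable def weightedCore : Matrix (Fin r₁) (Fin r₁) ℝ :=
  (weightedMatrix K m n).submatrix s.rowQR.sel s.colQR.sel

theorem weightedCore_eq :
    s.weightedCore = weightDiag s.rowQR.sel * s.core * weightDiag s.colQR.sel :=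
  weightedMatrix_submatrix K s.rowQR.sel s.colQR.sel

theorem isUnit_det_weightedCore : IsUnit s.weightedCore.det :=
  Matrix.det_transpose s.weightedCore ▸ s.rowQR.isUnit_det_cols s.rowQR_strong.isUnit

theorem isUnit_det_core : IsUnit s.core.det := by
  have h := s.isUnit_det_weightedCore
  rw [weightedCore_eq, Matrix.det_mul, Matrix.det_mul] at h
  exact isUnit_of_mul_isUnit_right (isUnit_of_mul_isUnit_left h)

theorem colQR_cols_eq : s.colQR.cols = s.rowQR.extInterp.transpose * s.weightedCore := by
  have h := congrArg Matrix.transpose <|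
    s.rowQR.cols_mul_extInterp_of_card_eq s.rowQR_strong.isUnit (by simp)
  rw [Matrix.transpose_mul, Matrix.transpose_transpose] at h
  exact h.symm

theorem errQR_eq_submatrix :
    s.errQR = s.colQR.err.submatrix s.rowQR.perm id := by
  have hrows : Matrix.fromRows (1 : Matrix (Fin r₁) (Fin r₁) ℝ) s.rowQR.interp.transpose =
      s.rowQR.extInterp.transpose.submatrix s.rowQR.perm id := by
    rw [← Matrix.transpose_submatrix, ← s.rowQR.fromCols_one_eq_submatrix_extInterp,
      Matrix.transpose_fromCols, Matrix.transpose_one]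
  have hcols : Matrix.fromRows (1 : Matrix (Fin r₁) (Fin r₁) ℝ) s.rowQR.interp.transpose *
      (weightedMatrix K m n).submatrix s.rowQR.sel s.colQR.sel =
      s.colQR.cols.submatrix s.rowQR.perm id := by
    rw [hrows]
    exact (congrArg (·.submatrix s.rowQR.perm id) s.colQR_cols_eq).symm
  rw [errQR, hcols]
  rfl

theorem eps_nonneg : 0 ≤ s.eps := norm_nonneg _

theorem eps_le_norm_err : s.eps ≤ ‖s.colQR.err‖ := by
  rw [eps, errQR_eq_submatrix]
  exact norm_submatrix_rows_le _ s.rowQR.perm.injective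

theorem norm_selected_rows_sub_le :
    ‖(weightedMatrix K m n).submatrix s.rowQR.sel id - s.weightedCore * s.colQR.extInterp‖ ≤
      s.eps := by
  have h : (weightedMatrix K m n).submatrix s.rowQR.sel id - s.weightedCore * s.colQR.extInterp =
      s.errQR.submatrix Sum.inl s.colQR.perm.symm := by
    rw [errQR, Matrix.fromRows_mul, Matrix.one_mul, Matrix.fromRows_mul]
    ext i j
    simp only [Matrix.sub_apply, Matrix.submatrix_apply, Equiv.apply_symm_apply]
    rfl
  rw [h]
  exact norm_submatrix_le _ Sum.inl_injective s.colQR.perm.symm.injective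

theorem norm_inv_weightedCore_mul_eps_le :
    ‖s.weightedCore⁻¹‖ * s.eps ≤
      MvPolynomial.eval ![(Fintype.card (Grid n) : ℝ), (r₁ : ℝ)] q₁ ^ 2 *
        (1 + frobNorm s.rowQR.interp) := by
  refine (norm_inv_mul_le_of_forall_norm_mulVec_ge s.rowQR.extInterp.transpose
    s.isUnit_det_weightedCore s.eps_nonneg (sq_nonneg _) fun v => ?_).trans
    (mul_le_mul_of_nonneg_left ?_ (sq_nonneg _))
  · rw [← colQR_cols_eq]
    exact (mul_le_mul_of_nonneg_right s.eps_le_norm_err (norm_nonneg _)).trans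
      (s.colQR_strong.norm_err_mul_norm_le v)
  · rw [norm_transpose]
    exact s.rowQR.norm_extInterp_le

theorem norm_inv_core_mul_eps_le :
    ‖s.core⁻¹‖ * s.eps ≤ (Real.pi ^ d) ^ 2 *
      (MvPolynomial.eval ![(Fintype.card (Grid n) : ℝ), (r₁ : ℝ)] q₁ ^ 2 *
        (1 + frobNorm s.rowQR.interp)) := by
  have hinv : s.core⁻¹ = weightDiag s.colQR.sel * s.weightedCore⁻¹ * weightDiag s.rowQR.sel := by
    rw [weightedCore_eq, Matrix.mul_inv_rev, Matrix.mul_inv_rev,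
      Matrix.mul_nonsing_inv_cancel_left _ _ (isUnit_det_weightDiag _),
      Matrix.nonsing_inv_mul_cancel_right _ _ (isUnit_det_weightDiag _)]
  calc ‖s.core⁻¹‖ * s.eps
      ≤ Real.pi ^ d * ‖s.weightedCore⁻¹‖ * Real.pi ^ d * s.eps := by
        rw [hinv]
        exact mul_le_mul_of_nonneg_right (norm_mul_mul_le_of_le (norm_weightDiag_le _) le_rfl
          (norm_weightDiag_le _)) s.eps_nonneg
    _ = (Real.pi ^ d) ^ 2 * (‖s.weightedCore⁻¹‖ * s.eps) := by ring
    _ ≤ _ := mul_le_mul_of_nonneg_left s.norm_inv_weightedCore_mul_eps_le (sq_nonneg _)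

/-- Row interpolation on the unweighted grid, with the square roots of the weights moved from the
matrix into the operator. -/
noncomputable def leftInterp : Matrix (Grid m) (Fin r₁) ℝ :=
  (weightDiag (id : Grid m → Grid m))⁻¹ * s.rowQR.extInterp.transpose * weightDiag s.rowQR.sel

/-- Column interpolation on the unweighted grid, with the square roots of the weights moved from
the matrix into the operator. -/
noncomputable def rightInterp : Matrix (Fin r₁) (Grid n) ℝ :=
  weightDiag s.colQR.sel * s.colQR.extInterp * (weightDiag (id : Grid n → Grid n))⁻¹

/-- The error of interpolating the selected rows of the unweighted matrix from the selected
columns. -/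
noncomputable def residual : Matrix (Fin r₁) (Grid n) ℝ :=
  (weightDiag s.rowQR.sel)⁻¹ *
    ((weightedMatrix K m n).submatrix s.rowQR.sel id - s.weightedCore * s.colQR.extInterp) *
    (weightDiag (id : Grid n → Grid n))⁻¹

theorem kernelMatrix_grid_Yhat :
    kernelMatrix K (gridPoint m) s.Yhat = s.leftInterp * s.core := by
  have hcols : weightDiag (id : Grid m → Grid m) * kernelMatrix K (gridPoint m) s.Yhat *
      weightDiag s.colQR.sel =
      s.rowQR.extInterp.transpose * (weightDiag s.rowQR.sel * s.core * weightDiag s.colQR.sel) := by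
    rw [← weightedCore_eq, ← colQR_cols_eq]
    exact (weightedMatrix_submatrix K id s.colQR.sel).symm
  calc kernelMatrix K (gridPoint m) s.Yhat
      = (weightDiag (id : Grid m → Grid m))⁻¹ * (weightDiag (id : Grid m → Grid m) *
          kernelMatrix K (gridPoint m) s.Yhat * weightDiag s.colQR.sel) *
          (weightDiag s.colQR.sel)⁻¹ := by
        rw [Matrix.mul_assoc (weightDiag _),
          Matrix.nonsing_inv_mul_cancel_left _ _ (isUnit_det_weightDiag _),
          Matrix.mul_nonsing_inv_cancel_right _ _ (isUnit_det_weightDiag _)]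
    _ = s.leftInterp * s.core := by
        rw [hcols, ← Matrix.mul_assoc, ← Matrix.mul_assoc,
          Matrix.mul_nonsing_inv_cancel_right _ _ (isUnit_det_weightDiag _), leftInterp]
        simp only [Matrix.mul_assoc]

theorem kernelMatrix_Xhat_grid :
    kernelMatrix K s.Xhat (gridPoint n) = s.core * s.rightInterp + s.residual := by
  have hrows : (weightedMatrix K m n).submatrix s.rowQR.sel id =
      weightDiag s.rowQR.sel * kernelMatrix K s.Xhat (gridPoint n) *
        weightDiag (id : Grid n → Grid n) :=
    weightedMatrix_submatrix K s.rowQR.sel id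
  have hcore : (weightDiag s.rowQR.sel)⁻¹ * (s.weightedCore * s.colQR.extInterp) *
      (weightDiag (id : Grid n → Grid n))⁻¹ = s.core * s.rightInterp := by
    simp only [weightedCore_eq, rightInterp, Matrix.mul_assoc,
      Matrix.nonsing_inv_mul_cancel_left _ _ (isUnit_det_weightDiag _)]
  have hkernel : (weightDiag s.rowQR.sel)⁻¹ * (weightedMatrix K m n).submatrix s.rowQR.sel id *
      (weightDiag (id : Grid n → Grid n))⁻¹ = kernelMatrix K s.Xhat (gridPoint n) := by
    rw [hrows, Matrix.mul_assoc (weightDiag _),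
      Matrix.nonsing_inv_mul_cancel_left _ _ (isUnit_det_weightDiag _),
      Matrix.mul_nonsing_inv_cancel_right _ _ (isUnit_det_weightDiag _)]
  rw [residual, Matrix.mul_sub, Matrix.sub_mul, hkernel, hcore, add_sub_cancel]

theorem leftOp_eq (x : Fin d → ℝ) :
    s.leftOp x = lagrangeMatrix m (fun _ : Unit => x) * s.leftInterp +
      kernelMatrix (interpError K m n) (fun _ : Unit => x) s.Yhat * s.core⁻¹ := by
  have hinterp : kernelMatrix K (fun _ : Unit => x) s.Yhat =
      lagrangeMatrix m (fun _ : Unit => x) * kernelMatrix K (gridPoint m) s.Yhat +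
        kernelMatrix (interpError K m n) (fun _ : Unit => x) s.Yhat :=
    kernelMatrix_gridPoint_right K m n _ s.colQR.sel
  rw [leftOp, hinterp, kernelMatrix_grid_Yhat, Matrix.add_mul, ← Matrix.mul_assoc,
    Matrix.mul_nonsing_inv_cancel_right _ _ s.isUnit_det_core]

theorem rightOp_eq (y : Fin d → ℝ) :
    s.rightOp y = s.rightInterp * (lagrangeMatrix n (fun _ : Unit => y)).transpose +
      s.core⁻¹ * (s.residual * (lagrangeMatrix n (fun _ : Unit => y)).transpose +
        kernelMatrix (interpError K m n) s.Xhat (fun _ : Unit => y)) := by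
  have hinterp : kernelMatrix K s.Xhat (fun _ : Unit => y) =
      kernelMatrix K s.Xhat (gridPoint n) * (lagrangeMatrix n (fun _ : Unit => y)).transpose +
        kernelMatrix (interpError K m n) s.Xhat (fun _ : Unit => y) :=
    kernelMatrix_gridPoint_left K m n s.rowQR.sel _
  rw [rightOp, hinterp, kernelMatrix_Xhat_grid, Matrix.add_mul, add_assoc, Matrix.mul_add,
    Matrix.mul_assoc s.core, Matrix.nonsing_inv_mul_cancel_left _ _ s.isUnit_det_core]

theorem norm_leftInterp_le :
    ‖s.leftInterp‖ ≤
      Fintype.card (Grid m) * (1 + frobNorm s.rowQR.interp) * Real.pi ^ d :=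
  norm_mul_mul_le_of_le (norm_inv_weightDiag_le _)
    ((norm_transpose _).trans_le s.rowQR.norm_extInterp_le) (norm_weightDiag_le _)

theorem norm_rightInterp_le :
    ‖s.rightInterp‖ ≤
      Real.pi ^ d * (1 + frobNorm s.colQR.interp) * Fintype.card (Grid n) :=
  norm_mul_mul_le_of_le (norm_weightDiag_le _) s.colQR.norm_extInterp_le
    (norm_inv_weightDiag_le _)

theorem norm_residual_le :
    ‖s.residual‖ ≤ Fintype.card (Grid m) * s.eps * Fintype.card (Grid n) :=
  norm_mul_mul_le_of_le (norm_inv_weightDiag_le _) s.norm_selected_rows_sub_le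
    (norm_inv_weightDiag_le _)

section Bounds

variable {s} (hK : ∀ x ∈ cube d, ∀ y ∈ cube d, |interpError K m n x y| ≤ s.eps)
include hK

theorem norm_leftOp_le {x : Fin d → ℝ} (hx : x ∈ cube d) :
    ‖s.leftOp x‖ ≤ Fintype.card (Grid m) * 2 ^ d * ‖s.leftInterp‖ +
      r₁ * (‖s.core⁻¹‖ * s.eps) := by
  have hlagrange := norm_lagrangeMatrix_le m (X := fun _ : Unit => x) fun _ => hx
  have herror := norm_le_card_mul_of_forall_abs_le s.eps_nonneg
    (A := kernelMatrix (interpError K m n) (fun _ : Unit => x) s.Yhat)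
    fun _ _ => hK x hx _ (gridPoint_mem_cube _ _)
  rw [Fintype.card_unit, Nat.cast_one, one_mul] at hlagrange herror
  rw [Fintype.card_fin] at herror
  rw [leftOp_eq]
  calc _ ≤ _ := norm_add_le _ _
    _ ≤ _ := add_le_add (Matrix.l2_opNorm_mul _ _) (Matrix.l2_opNorm_mul _ _)
    _ ≤ Fintype.card (Grid m) * 2 ^ d * ‖s.leftInterp‖ + r₁ * s.eps * ‖s.core⁻¹‖ := by gcongr
    _ = _ := by ring

theorem norm_rightOp_le {y : Fin d → ℝ} (hy : y ∈ cube d) :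
    ‖s.rightOp y‖ ≤ ‖s.rightInterp‖ * (Fintype.card (Grid n) * 2 ^ d) +
      ‖s.core⁻¹‖ * s.eps * (Fintype.card (Grid m) * Fintype.card (Grid n) *
        (Fintype.card (Grid n) * 2 ^ d) + r₁) := by
  have hlagrange := norm_lagrangeMatrix_le n (X := fun _ : Unit => y) fun _ => hy
  have herror := norm_le_card_mul_of_forall_abs_le s.eps_nonneg
    (A := kernelMatrix (interpError K m n) s.Xhat (fun _ : Unit => y))
    fun _ _ => hK _ (gridPoint_mem_cube _ _) y hy
  rw [Fintype.card_unit, Nat.cast_one, one_mul, ← norm_transpose] at hlagrange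
  rw [Fintype.card_unit, Nat.cast_one, mul_one, Fintype.card_fin] at herror
  have hresidual := (Matrix.l2_opNorm_mul s.residual _).trans
    (mul_le_mul s.norm_residual_le hlagrange (norm_nonneg _) (by have := s.eps_nonneg; positivity))
  rw [rightOp_eq]
  calc _ ≤ _ := norm_add_le _ _
    _ ≤ _ := add_le_add (Matrix.l2_opNorm_mul _ _) ((Matrix.l2_opNorm_mul _ _).trans
        (mul_le_mul_of_nonneg_left (norm_add_le _ _) (norm_nonneg _)))
    _ ≤ ‖s.rightInterp‖ * (Fintype.card (Grid n) * 2 ^ d) +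
        ‖s.core⁻¹‖ * (Fintype.card (Grid m) * s.eps * Fintype.card (Grid n) *
          (Fintype.card (Grid n) * 2 ^ d) + r₁ * s.eps) := by gcongr
    _ = _ := by ring

end Bounds

section GrowthBound

variable {s} {N a t : ℝ}
  (hm : Fintype.card (Grid m) ≤ N) (hn : Fintype.card (Grid n) ≤ N)
  (ha : |MvPolynomial.eval ![(Fintype.card (Grid n) : ℝ), (r₁ : ℝ)] q₁| ≤ a)
  (hrow : frobNorm s.rowQR.interp ≤ t) (hcol : frobNorm s.colQR.interp ≤ t)

include ha hrow in
theorem norm_inv_core_mul_eps_le_of_le :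
    ‖s.core⁻¹‖ * s.eps ≤ (Real.pi ^ d) ^ 2 * a ^ 2 * (1 + t) := by
  have hfrob := frobNorm_nonneg s.rowQR.interp
  refine s.norm_inv_core_mul_eps_le.trans ?_
  rw [mul_assoc, ← sq_abs (MvPolynomial.eval _ _)]
  gcongr

include hm ha hrow in
theorem condNumber_core_mul_eps_le :
    condNumber s.core * s.eps ≤ growthBound (Real.pi ^ d) (2 ^ d) N a t * ‖s.core‖ := by
  have hN : 0 ≤ N := (Nat.cast_nonneg _).trans hm
  have ht : 0 ≤ t := (frobNorm_nonneg _).trans hrow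
  have hcore := norm_inv_core_mul_eps_le_of_le ha hrow
  calc condNumber s.core * s.eps = ‖s.core⁻¹‖ * s.eps * ‖s.core‖ := by rw [condNumber]; ring
    _ ≤ (Real.pi ^ d) ^ 2 * a ^ 2 * (1 + t) * ‖s.core‖ := by
        gcongr
    _ ≤ growthBound (Real.pi ^ d) (2 ^ d) N a t * ‖s.core‖ := by
        gcongr
        rw [growthBound]
        refine le_add_of_nonneg_of_le (by positivity) (le_mul_of_one_le_right (by positivity) ?_)
        exact le_add_of_nonneg_left (by positivity)

variable (hK : ∀ x ∈ cube d, ∀ y ∈ cube d, |interpError K m n x y| ≤ s.eps)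

include hm ha hrow hK in
theorem norm_leftOp_le_growthBound {x : Fin d → ℝ} (hx : x ∈ cube d) :
    ‖s.leftOp x‖ ≤ growthBound (Real.pi ^ d) (2 ^ d) N a t := by
  have hN : 0 ≤ N := (Nat.cast_nonneg _).trans hm
  have ht : 0 ≤ t := (frobNorm_nonneg _).trans hrow
  have hr : (r₁ : ℝ) ≤ N := (Nat.cast_le.2 s.rank_le_card_grid).trans hm
  have hcore := norm_inv_core_mul_eps_le_of_le ha hrow
  have heps := s.eps_nonneg
  have hfrob := frobNorm_nonneg s.rowQR.interp
  have hinterp : ‖s.leftInterp‖ ≤ N * (1 + t) * Real.pi ^ d :=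
    s.norm_leftInterp_le.trans (by gcongr)
  calc ‖s.leftOp x‖ ≤ _ := norm_leftOp_le hK hx
    _ ≤ N * 2 ^ d * (N * (1 + t) * Real.pi ^ d) +
        N * ((Real.pi ^ d) ^ 2 * a ^ 2 * (1 + t)) := by
        gcongr
    _ = Real.pi ^ d * (1 + t) * N * (2 ^ d * N) +
        (Real.pi ^ d) ^ 2 * a ^ 2 * (1 + t) * N := by ring
    _ ≤ growthBound (Real.pi ^ d) (2 ^ d) N a t := by
        rw [growthBound]
        gcongr
        rw [add_right_comm]
        exact le_add_of_nonneg_left (by positivity)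

include hm hn ha hrow hcol hK in
theorem norm_rightOp_le_growthBound {y : Fin d → ℝ} (hy : y ∈ cube d) :
    ‖s.rightOp y‖ ≤ growthBound (Real.pi ^ d) (2 ^ d) N a t := by
  have hN : 0 ≤ N := (Nat.cast_nonneg _).trans hm
  have ht : 0 ≤ t := (frobNorm_nonneg _).trans hrow
  have hr : (r₁ : ℝ) ≤ N := (Nat.cast_le.2 s.rank_le_card_grid).trans hm
  have hcore := norm_inv_core_mul_eps_le_of_le ha hrow
  have hinterp : ‖s.rightInterp‖ ≤ Real.pi ^ d * (1 + t) * N :=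
    s.norm_rightInterp_le.trans (by gcongr)
  calc ‖s.rightOp y‖ ≤ _ := norm_rightOp_le hK hy
    _ ≤ Real.pi ^ d * (1 + t) * N * (N * 2 ^ d) +
        (Real.pi ^ d) ^ 2 * a ^ 2 * (1 + t) * (N * N * (N * 2 ^ d) + N) := by
        gcongr
    _ ≤ growthBound (Real.pi ^ d) (2 ^ d) N a t := by
        rw [growthBound, mul_comm N (2 ^ d)]
        exact add_le_add_right (mul_le_mul_of_nonneg_left
          (le_add_of_nonneg_right zero_le_one) (by positivity)) _

end GrowthBound

end Skeleton

end SkelInterp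

/-- `q₁`, `q₂` are the polynomials of the strong rank-revealing QR factorizations; `B`, `b` say
that the sizes of the two grids are polynomially comparable. The polynomial `q` and the constant
`C` depend on nothing else but the dimension. -/
theorem lemma4 (d : ℕ) (q₁ q₂ : MvPolynomial (Fin 2) ℝ) (B b : ℕ) :
    ∃ (q : MvPolynomial (Fin 2) ℝ) (C : ℝ), 0 < C ∧
      ∀ (K : (Fin d → ℝ) → (Fin d → ℝ) → ℝ) (m n : Fin d → ℕ) (r₁ : ℕ)
        (s : SkelInterp.Skeleton K m n r₁ q₁ q₂) (δ : ℝ),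
        (∀ i, 0 < m i) → (∀ i, 0 < n i) →
        max (Fintype.card (SkelInterp.Grid m)) (Fintype.card (SkelInterp.Grid n)) ≤
          B * SkelInterp.interpRank m n ^ b →
        (∀ x ∈ SkelInterp.cube d, ∀ y ∈ SkelInterp.cube d,
          |SkelInterp.interpError K m n x y| ≤ δ) →
        δ ≤ s.eps →
        IsUnit s.core ∧
        (∀ x ∈ SkelInterp.cube d, ∀ y ∈ SkelInterp.cube d,
          ‖s.leftOp x‖ ≤
            C * MvPolynomial.eval ![(SkelInterp.interpRank m n : ℝ), (r₁ : ℝ)] q ∧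
          ‖s.rightOp y‖ ≤
            C * MvPolynomial.eval ![(SkelInterp.interpRank m n : ℝ), (r₁ : ℝ)] q) ∧
        SkelInterp.condNumber s.core * s.eps ≤
          C * MvPolynomial.eval ![(SkelInterp.interpRank m n : ℝ), (r₁ : ℝ)] q * ‖s.core‖ := by
  open SkelInterp MvPolynomial in
  obtain ⟨P₁, hP₁⟩ := exists_forall_abs_eval_le_of_le_mul_pow q₁ B b
  obtain ⟨P₂, hP₂⟩ := exists_forall_abs_eval_le_of_le_mul_pow q₂ B b
  refine ⟨growthBound (C (Real.pi ^ d)) (C (2 ^ d)) (C (B : ℝ) * X 0 ^ b) P₁ P₂, 1, one_pos, ?_⟩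
  intro K m n r₁ s δ _ _ hsize hδ hδs
  obtain ⟨hm, hn⟩ := max_le_iff.1 hsize
  have ha := hP₁ _ _ r₁ hn
  have hrow := s.rowQR_strong.interp_le.trans ((le_abs_self _).trans (hP₂ _ _ r₁ hm))
  have hcol := s.colQR_strong.interp_le.trans ((le_abs_self _).trans (hP₂ _ _ r₁ hn))
  have hK := fun x hx y hy => (hδ x hx y hy).trans hδs
  have hm' : (Fintype.card (Grid m) : ℝ) ≤ B * (interpRank m n : ℝ) ^ b := by exact_mod_cast hm
  have hn' : (Fintype.card (Grid n) : ℝ) ≤ B * (interpRank m n : ℝ) ^ b := by exact_mod_cast hn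
  simp only [one_mul, map_growthBound, eval_C, map_mul, map_pow, eval_X, Matrix.cons_val_zero]
  exact ⟨(Matrix.isUnit_iff_isUnit_det _).2 s.isUnit_det_core,
    fun x hx y hy => ⟨Skeleton.norm_leftOp_le_growthBound hm' ha hrow hK hx,
      Skeleton.norm_rightOp_le_growthBound hm' hn' ha hrow hcol hK hy⟩,
    Skeleton.condNumber_core_mul_eps_le hm' ha hrow⟩
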